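/- Let $\kappa$ be an infinite cardinal. The class $\mathfrak{k}_\kappa$ is defined as follows. Its vocabulary has unary predicates $P,\Gamma,I,J$, binary predicates $R_1,R_2$, unary functions $F_i$ ($i\le\kappa$) and constants $c_i$ ($i<\kappa$). A structure $M$ belongs to $K_{\mathfrak{k}_\kappa}$ iff: * its universe is the disjoint union of $P^M$ (propositional variables), $\Gamma^M$ (sentences), $I^M$ (theories) and $J^M$ (truth assignments), and the $c_i^M$ are pairwise distinct elements of $P^M$; * for $i<\kappa$, $F_i^M:\Gamma^M\to P^M$, and $\Gamma^M$ is a set of sentences, each of one of the following four forms, the form and the constituents of $\varphi\in\Gamma^M$ being recorded by the $F_i=F_i^M(\varphi)$, so that different elements of $\Gamma^M$ are different sentences (have different sequences $\langle F_i^M(\varphi):i<\kappa\rangle$): * $\varphi=(p)$: $F_0=c_0$ and $F_i=p$ for $i\ge 1$; * $\varphi=(r\equiv p\wedge q)$: $F_0=c_1$, $F_1=p$, $F_2=q$ and $F_i=r$ for $i\ge 3$; * $\varphi=(q\equiv\neg p)$: $F_0=c_2$, $F_1=p$ and $F_i=q$ for $i\ge 2$; * $\varphi=(q\equiv\bigwedge_{j<\kappa}p_j)$: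 $F_0=c_3$, $F_1=q$ and $F_{2+j}=p_j$ for $j<\kappa$; here $p,q,r,p_j$ are arbitrary elements of $P^M$; * $R_1^M\subseteq\Gamma^M\times I^M$; for $t\in I^M$ let $\Gamma^M_t=\{\varphi\in\Gamma^M:\varphi\,R_1^M\,t\}$; * $R_2^M\subseteq(\Gamma^M\cup P^M)\times J^M$; each $s\in J^M$ gives the truth assignment $\mathcal{M}_s$ on $P^M$ in which $p$ is true iff $p\,R_2^M\,s$, and, for $\varphi\in\Gamma^M$, $\varphi\,R_2^M\,s$ iff $\varphi$ is true in $\mathcal{M}_s$; * $F_\kappa^M$ maps $J^M$ onto $I^M$, and $\mathcal{M}_s$ satisfies $\Gamma^M_{F_\kappa^M(s)}$ for every $s\in J^M$. The functions $F_i^M$ ($i<\kappa$) and $F_\kappa^M$ are the identity outside $\Gamma^M$ and $J^M$ respectively. For $M,N\in K_{\mathfrak{k}_\kappa}$, $M\le_{\mathfrak{k}_\kappa}N$ means that $M$ is a substructure of $N$. This is an abstract elementary class (a.e.c.). For an a.e.c. $\mathfrak{k}$ and $M\in K_{\mathfrak{k}}$, $\mathscr{S}^{<\omega}(M)$ is the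 set of types $\mathrm{tp}(\bar a,M,N)$, where $M\le_{\mathfrak{k}}N$ and $\bar a$ is a finite sequence of elements of $N$; equality of types over $M$ is the equivalence relation on the triples $(\bar a,M,N)$ generated by: $(\bar a_1,M,N_1)$ and $(\bar a_2,M,N_2)$ are related if some $\le_{\mathfrak{k}}$-embedding of $N_1$ into $N_2$ is the identity on $M$ and maps $\bar a_1$ to $\bar a_2$. For $M_0\le_{\mathfrak{k}}M$, $\mathrm{tp}(\bar a,M,N)\restriction M_0=\mathrm{tp}(\bar a,M_0,N)$. For a cardinal $\lambda$ and a regular cardinal $\theta$, $\mathfrak{k}$ is *$(\lambda,\theta)$-compact (for types)* if, whenever $\langle M_i:i\le\theta\rangle$ is $\le_{\mathfrak{k}}$-increasing continuous with $\|M_i\|\le\lambda$ for $i<\theta$, and $\mathbf{p}_i\in\mathscr{S}^{<\omega}(M_i)$ ($i<\theta$) satisfy $\mathbf{p}_i=\mathbf{p}_j\restriction M_i$ for $i<j<\theta$, there is $\mathbf{p}_\theta\in\mathscr{S}^{<\omega}(M_\theta)$ with $\mathbf{p}_\theta\restriction M_i=\mathbf{p}_i$ for all $i<\theta$. **Theorem.**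 Let $\theta>\kappa\ge\aleph_0$ with $\theta$ a regular cardinal such that there is no $\kappa^+$-complete uniform ultrafilter on $\theta$ (uniform: every member has cardinality $\theta$; $\kappa^+$-complete: closed under intersections of at most $\kappa$ members), and let $\lambda=2^\theta$. Then $\mathfrak{k}_\kappa$ is not $(\lambda,\theta)$-compact for types. -/

import Mathlib

open Cardinal Set FirstOrder FirstOrder.Language

universe u v w

/-! ## Abstract elementary classes

An a.e.c. `𝔨 = (K, ≤)` in the vocabulary `L` is presented by its class `K` of models and by its
`≤`-embeddings: `Strong f` says that `f : M → N` is an isomorphism of `M` onto some `M' ≤ N`. In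
particular `M ≤ N` for a substructure `M` of `N` is `Strong` of the inclusion map. -/

/-- Abstract elementary classes, with the usual axioms. -/
structure AEC (L : FirstOrder.Language.{v, w}) where
  /-- `M` belongs to the class `K`. -/
  Mem : ∀ (M : Type u) [L.Structure M], Prop
  /-- `f` is a `≤`-embedding. -/
  Strong : ∀ {M N : Type u} [L.Structure M] [L.Structure N], (M ↪[L] N) → Prop
  mem_left : ∀ {M N : Type u} [L.Structure M] [L.Structure N] (f : M ↪[L] N),
    Strong f → Mem M
  mem_right : ∀ {M N : Type u} [L.Structure M] [L.Structure N] (f : M ↪[L] N),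
    Strong f → Mem N
  /-- Closure under isomorphism; with `N = M` this is also reflexivity of `≤`. -/
  iso : ∀ {M N : Type u} [L.Structure M] [L.Structure N] (e : M ≃[L] N),
    Mem M → Mem N ∧ Strong e.toEmbedding
  /-- Transitivity. -/
  comp : ∀ {M N N' : Type u} [L.Structure M] [L.Structure N] [L.Structure N']
    (g : N ↪[L] N') (f : M ↪[L] N), Strong g → Strong f → Strong (g.comp f)
  /-- Coherence: if `M ⊆ N ≤ N'` and `M ≤ N'` then `M ≤ N`. -/
  coherence : ∀ {M N N' : Type u} [L.Structure M] [L.Structure N] [L.Structure N']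
    (g : N ↪[L] N') (f : M ↪[L] N), Strong g → Strong (g.comp f) → Strong f
  /-- The union of a `≤`-increasing chain is in `K`, is a `≤`-upper bound of the chain, and is `≤`
  every model of which all members of the chain are `≤`-submodels. -/
  union : ∀ {M : Type u} [L.Structure M] {ι : Type u} [LinearOrder ι] [WellFoundedLT ι]
    [Nonempty ι] (S : ι →o L.Substructure M),
    (∀ (i j : ι) (h : i ≤ j), Strong (Substructure.inclusion (S.monotone h))) →
    (∀ x : M, ∃ i, x ∈ S i) →
    Mem M ∧ (∀ i, Strong (S i).subtype) ∧
      ∀ {N : Type u} [L.Structure N] (f : M ↪[L] N),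
        (∀ i, Strong (f.comp (S i).subtype)) → Strong f
  /-- There is a Löwenheim–Skolem–Tarski number. -/
  exists_LST : ∃ χ : Cardinal.{u}, ℵ₀ ≤ χ ∧ ∀ (M : Type u) [L.Structure M], Mem M →
    ∀ A : Set M, ∃ S : L.Substructure M, A ⊆ S ∧ Strong S.subtype ∧ #S ≤ #A + χ

namespace AEC

section types

variable {L : FirstOrder.Language.{v, w}} (K : AEC.{u, v, w} L)

/-- A triple `(M, N, a)` with `M ≤ N` (up to renaming elements) and `a` a finite sequence of
elements of `N`. -/
structure PointedExt (M : Type u) [L.Structure M] where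
  carrier : Type u
  [str : L.Structure carrier]
  emb : M ↪[L] carrier
  strong : K.Strong emb
  tuple : List carrier

attribute [instance] PointedExt.str

/-- The basic step of equality of types: `N₁` embeds `≤`-ly into `N₂` over `M`, mapping `a₁` to
`a₂`. -/
def Step {M : Type u} [L.Structure M] (x y : K.PointedExt M) : Prop :=
  ∃ g : x.carrier ↪[L] y.carrier,
    K.Strong g ∧ g.comp x.emb = y.emb ∧ x.tuple.map g = y.tuple

/-- The set (here: a type) of orbital types of finite sequences over `M`: triples `(M, N, a)`
modulo the equivalence relation generated by `Step`, that is, two triples are identified when they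
are connected by a finite zigzag of `≤`-embeddings over `M` respecting the sequences. No
amalgamation is assumed. -/
def FinType (M : Type u) [L.Structure M] :=
  Quot (K.Step (M := M))

/-- The orbital type `tp(a, M, N)`. -/
def tp {M : Type u} [L.Structure M] (x : K.PointedExt M) : K.FinType M :=
  Quot.mk _ x

/-- The triple `(M₀, N, a)` obtained from `(M, N, a)` when `M₀ ≤ M`. -/
def PointedExt.restrict {K : AEC.{u, v, w} L} {M₀ M : Type u} [L.Structure M₀] [L.Structure M]
    (h : M₀ ↪[L] M) (hh : K.Strong h) (x : K.PointedExt M) : K.PointedExt M₀ where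
  carrier := x.carrier
  emb := x.emb.comp h
  strong := K.comp _ _ x.strong hh
  tuple := x.tuple

/-- Restriction of types: `tp(a, M, N) ↾ M₀ = tp(a, M₀, N)`. -/
def restrict {M₀ M : Type u} [L.Structure M₀] [L.Structure M]
    (h : M₀ ↪[L] M) (hh : K.Strong h) : K.FinType M → K.FinType M₀ :=
  Quot.map (PointedExt.restrict h hh) (by
    rintro x y ⟨g, hg, h1, h2⟩
    refine ⟨g, hg, ?_, h2⟩
    change g.comp (x.emb.comp h) = y.emb.comp h
    rw [← h1, Embedding.comp_assoc])

/-- A `≤`-increasing continuous sequence `⟨M_i : i ≤ δ⟩`; the models are substructures of a common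
structure. -/
structure Chain (δ : Ordinal.{u}) where
  carrier : Type u
  [str : L.Structure carrier]
  sub : Set.Iic δ →o L.Substructure carrier
  strong : ∀ (i j : Set.Iic δ) (h : i ≤ j), K.Strong (Substructure.inclusion (sub.monotone h))
  continuous : ∀ i : Set.Iic δ, Order.IsSuccLimit (i : Ordinal.{u}) →
    ∀ x ∈ sub i, ∃ j < i, x ∈ sub j

attribute [instance] Chain.str

variable {K} in
/-- The model `M_i` of the sequence. -/
abbrev Chain.model {δ : Ordinal.{u}} (C : K.Chain δ) (i : Ordinal.{u}) (hi : i ≤ δ) : Type u :=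
  C.sub ⟨i, hi⟩

variable {K} in
/-- Restriction of a type over `M_j` to `M_i`, for `i ≤ j`. -/
def Chain.restrict {δ : Ordinal.{u}} (C : K.Chain δ) {i j : Ordinal.{u}} (hij : i ≤ j)
    (hj : j ≤ δ) : K.FinType (C.model j hj) → K.FinType (C.model i (hij.trans hj)) :=
  K.restrict _ (C.strong ⟨i, hij.trans hj⟩ ⟨j, hj⟩ hij)

/-- `(≤ lam, μ)`-compactness for types, also called `(lam, μ)`-compactness: for every
`≤`-increasing continuous `⟨M_i : i ≤ μ⟩` with `‖M_i‖ ≤ lam` for `i < μ`, every coherent sequence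
of types `p_i` over `M_i` (`i < μ`) has an extension over `M_μ`. -/
def IsCompactForTypes (lam μ : Cardinal.{u}) : Prop :=
  ∀ C : K.Chain μ.ord,
    (∀ (i : Ordinal.{u}) (hi : i < μ.ord), #(C.model i hi.le) ≤ lam) →
    ∀ p : ∀ (i : Ordinal.{u}) (hi : i < μ.ord), K.FinType (C.model i hi.le),
      (∀ (i j : Ordinal.{u}) (hij : i < j) (hj : j < μ.ord),
        p i (hij.trans hj) = C.restrict hij.le hj.le (p j hj)) →
      ∃ q : K.FinType (C.model μ.ord le_rfl),
        ∀ (i : Ordinal.{u}) (hi : i < μ.ord), C.restrict hi.le le_rfl q = p i hi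

end types

end AEC

/-! ## The class `𝔨_κ` of models coding propositional theories -/

namespace PropAEC

/-- The four sorts: propositional variables, sentences, (indices of) theories, (indices of) truth
assignments. -/
inductive Kind : Type
  | P | Γ | I | J

/-- Function symbols: unary `F_i` for `i < κ`, the unary `F_κ`, and constants `c_i` for `i < κ`. -/
inductive Func (κ : Cardinal.{u}) : ℕ → Type u
  | F : κ.ord.ToType → Func κ 1
  | Fκ : Func κ 1
  | c : κ.ord.ToType → Func κ 0

/-- Predicates: the unary `P, Γ, I, J` and the binary `R₁, R₂`. -/
inductive Rel : ℕ → Type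
  | kind : Kind → Rel 1
  | R₁ : Rel 2
  | R₂ : Rel 2

/-- The vocabulary of `𝔨_κ`. -/
def lang (κ : Cardinal.{u}) : FirstOrder.Language.{u, 0} where
  Functions := Func κ
  Relations := Rel

section symbols

variable (κ : Cardinal.{u}) {M : Type u} [(lang κ).Structure M]

/-- `x` is of the sort `k`. -/
def Is (k : Kind) (x : M) : Prop :=
  Structure.RelMap (L := lang κ) (Rel.kind k) ![x]

/-- `φ` belongs to the theory `t`. -/
def R₁ (φ t : M) : Prop :=
  Structure.RelMap (L := lang κ) Rel.R₁ ![φ, t]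

/-- The variable or sentence `x` is true in the truth assignment `s`. -/
def R₂ (x s : M) : Prop :=
  Structure.RelMap (L := lang κ) Rel.R₂ ![x, s]

variable {κ} in
/-- `F_i`, for `i < κ`. -/
def F (i : κ.ord.ToType) (x : M) : M :=
  Structure.funMap (L := lang κ) (Func.F i) ![x]

/-- `F_κ`. -/
def Fκ (x : M) : M :=
  Structure.funMap (L := lang κ) (Func.Fκ : Func κ 1) ![x]

variable {κ} (M) in
/-- The constant `c_i`, for `i < κ`. -/
def c (i : κ.ord.ToType) : M :=
  Structure.funMap (L := lang κ) (Func.c i) ![]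

end symbols

section sentences

variable {κ : Cardinal.{u}} (hκ : ℵ₀ ≤ κ) {M : Type u} [(lang κ).Structure M]

/-- The finite ordinal `n`, as an index below the infinite cardinal `κ`. -/
noncomputable def idx (n : ℕ) : κ.ord.ToType :=
  Ordinal.ToType.mk ⟨(n : Ordinal.{u}),
    (Ordinal.natCast_lt_omega0 n).trans_le (Cardinal.omega0_le_ord.2 hκ)⟩

/-- `φ` codes the sentence `(p)`. -/
def CodesVar (φ p : M) : Prop :=
  F (idx hκ 0) φ = c M (idx hκ 0) ∧ ∀ i, idx hκ 1 ≤ i → F i φ = p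

/-- `φ` codes the sentence `(r ≡ p ∧ q)`. -/
def CodesAnd (φ r p q : M) : Prop :=
  F (idx hκ 0) φ = c M (idx hκ 1) ∧ F (idx hκ 1) φ = p ∧ F (idx hκ 2) φ = q ∧
    ∀ i, idx hκ 3 ≤ i → F i φ = r

/-- `φ` codes the sentence `(q ≡ ¬ p)`. -/
def CodesNot (φ q p : M) : Prop :=
  F (idx hκ 0) φ = c M (idx hκ 2) ∧ F (idx hκ 1) φ = p ∧ ∀ i, idx hκ 2 ≤ i → F i φ = q

/-- `φ` codes the sentence `(q ≡ ⋀ p_i)`; the `κ` conjuncts `p_i` are indexed by the ordinals `i`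
with `2 ≤ i < κ`, so that they are the values `F_i(φ)` for these `i`. -/
def CodesConj (φ q : M) (p : {i : κ.ord.ToType // idx hκ 2 ≤ i} → M) : Prop :=
  F (idx hκ 0) φ = c M (idx hκ 3) ∧ F (idx hκ 1) φ = q ∧ ∀ i, F i.1 φ = p i

end sentences

/-- `M` is a model in the class `𝔨_κ`. The functions `F_i` (on `Γ`) and `F_κ` (on `J`) are partial
in the mathematical text; outside their domains they are the identity here. -/
structure IsModel (κ : Cardinal.{u}) (hκ : ℵ₀ ≤ κ) (M : Type u) [(lang κ).Structure M] :
    Prop where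
  /-- The universe is the disjoint union of `P, Γ, I, J`. -/
  partition : ∀ x : M, ∃! k : Kind, Is κ k x
  c_mem : ∀ i, Is κ .P (c (κ := κ) M i)
  c_inj : Function.Injective (c (κ := κ) M)
  F_mem : ∀ i (φ : M), Is κ .Γ φ → Is κ .P (F (κ := κ) i φ)
  F_off : ∀ i (x : M), ¬ Is κ .Γ x → F (κ := κ) i x = x
  /-- Every element of `Γ` is a sentence of one of the four forms. -/
  form : ∀ φ : M, Is κ .Γ φ →
    (∃ p, CodesVar hκ φ p) ∨ (∃ r p q, CodesAnd hκ φ r p q) ∨ (∃ q p, CodesNot hκ φ q p) ∨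
      ∃ q p, CodesConj hκ φ q p
  /-- Different elements of `Γ` are different sentences. -/
  ext : ∀ φ ψ : M, Is κ .Γ φ → Is κ .Γ ψ → (∀ i, F (κ := κ) i φ = F i ψ) → φ = ψ
  R₁_sub : ∀ φ t : M, R₁ κ φ t → Is κ .Γ φ ∧ Is κ .I t
  R₂_sub : ∀ x s : M, R₂ κ x s → (Is κ .Γ x ∨ Is κ .P x) ∧ Is κ .J s
  /-- `R₂` on sentences is computed from the truth values `R₂` of the variables. -/
  true_var : ∀ φ s p : M, Is κ .Γ φ → Is κ .J s → CodesVar hκ φ p → (R₂ κ φ s ↔ R₂ κ p s)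
  true_and : ∀ φ s r p q : M, Is κ .Γ φ → Is κ .J s → CodesAnd hκ φ r p q →
    (R₂ κ φ s ↔ (R₂ κ r s ↔ R₂ κ p s ∧ R₂ κ q s))
  true_not : ∀ φ s q p : M, Is κ .Γ φ → Is κ .J s → CodesNot hκ φ q p →
    (R₂ κ φ s ↔ (R₂ κ q s ↔ ¬ R₂ κ p s))
  true_conj : ∀ (φ s q : M) (p : {i : κ.ord.ToType // idx hκ 2 ≤ i} → M),
    Is κ .Γ φ → Is κ .J s → CodesConj hκ φ q p →
    (R₂ κ φ s ↔ (R₂ κ q s ↔ ∀ i, R₂ κ (p i) s))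
  Fκ_mem : ∀ s : M, Is κ .J s → Is κ .I (Fκ κ s)
  Fκ_off : ∀ x : M, ¬ Is κ .J x → Fκ κ x = x
  /-- The truth assignment `s` satisfies the theory `F_κ(s)`. -/
  models : ∀ s φ : M, Is κ .J s → R₁ κ φ (Fκ κ s) → R₂ κ φ s
  /-- Every theory `t ∈ I` is `F_κ(s)` for some `s ∈ J`. -/
  onto : ∀ t : M, Is κ .I t → ∃ s : M, Is κ .J s ∧ Fκ κ s = t

section lemmas

variable {κ : Cardinal.{u}} {hκ : ℵ₀ ≤ κ} {M N : Type u} [(lang κ).Structure M]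
  [(lang κ).Structure N] (f : M ↪[lang κ] N)

theorem is_map (k : Kind) (x : M) : Is κ k (f x) ↔ Is κ k x := by
  have := f.map_rel (Rel.kind k : (lang κ).Relations 1) ![x]
  rw [show (f ∘ ![x] : Fin 1 → N) = ![f x] by ext i; fin_cases i; rfl] at this
  exact this

theorem R₁_map (x y : M) : R₁ κ (f x) (f y) ↔ R₁ κ x y := by
  have := f.map_rel (Rel.R₁ : (lang κ).Relations 2) ![x, y]
  rw [show (f ∘ ![x, y] : Fin 2 → N) = ![f x, f y] by ext i; fin_cases i <;> rfl] at this
  exact this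

theorem R₂_map (x y : M) : R₂ κ (f x) (f y) ↔ R₂ κ x y := by
  have := f.map_rel (Rel.R₂ : (lang κ).Relations 2) ![x, y]
  rw [show (f ∘ ![x, y] : Fin 2 → N) = ![f x, f y] by ext i; fin_cases i <;> rfl] at this
  exact this

theorem F_map (i : κ.ord.ToType) (x : M) : F i (f x) = f (F i x) := by
  have := f.map_fun (Func.F i : (lang κ).Functions 1) ![x]
  rw [show (f ∘ ![x] : Fin 1 → N) = ![f x] by ext i; fin_cases i; rfl] at this
  exact this.symm

theorem Fκ_map (x : M) : Fκ κ (f x) = f (Fκ κ x) := by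
  have := f.map_fun (Func.Fκ : (lang κ).Functions 1) ![x]
  rw [show (f ∘ ![x] : Fin 1 → N) = ![f x] by ext i; fin_cases i; rfl] at this
  exact this.symm

theorem c_map (i : κ.ord.ToType) : c N i = f (c M i) := by
  have := f.map_fun (Func.c i : (lang κ).Functions 0) ![]
  simpa [c, Matrix.empty_eq] using this.symm

theorem codesVar_map (φ p : M) : CodesVar hκ (f φ) (f p) ↔ CodesVar hκ φ p := by
  simp only [CodesVar, F_map, c_map f, f.injective.eq_iff]

theorem codesAnd_map (φ r p q : M) :
    CodesAnd hκ (f φ) (f r) (f p) (f q) ↔ CodesAnd hκ φ r p q := by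
  simp only [CodesAnd, F_map, c_map f, f.injective.eq_iff]

theorem codesNot_map (φ q p : M) : CodesNot hκ (f φ) (f q) (f p) ↔ CodesNot hκ φ q p := by
  simp only [CodesNot, F_map, c_map f, f.injective.eq_iff]

theorem codesConj_map (φ q : M) (p : {i : κ.ord.ToType // idx hκ 2 ≤ i} → M) :
    CodesConj hκ (f φ) (f q) (fun i => f (p i)) ↔ CodesConj hκ φ q p := by
  simp only [CodesConj, F_map, c_map f, f.injective.eq_iff]

theorem form_iff (φ : M) :
    ((∃ p, CodesVar hκ φ p) ∨ (∃ r p q, CodesAnd hκ φ r p q) ∨ (∃ q p, CodesNot hκ φ q p) ∨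
      ∃ q p, CodesConj hκ φ q p) ↔
    (CodesVar hκ φ (F (idx hκ 1) φ) ∨
      CodesAnd hκ φ (F (idx hκ 3) φ) (F (idx hκ 1) φ) (F (idx hκ 2) φ) ∨
      CodesNot hκ φ (F (idx hκ 2) φ) (F (idx hκ 1) φ) ∨
      CodesConj hκ φ (F (idx hκ 1) φ) (fun i => F i.1 φ)) := by
  constructor
  · rintro (⟨p, h⟩ | ⟨r, p, q, h⟩ | ⟨q, p, h⟩ | ⟨q, p, h⟩)
    · left; rw [h.2 _ le_rfl]; exact h
    · right; left; rw [h.2.1, h.2.2.1, h.2.2.2 _ le_rfl]; exact h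
    · right; right; left; rw [h.2.1, h.2.2 _ le_rfl]; exact h
    · right; right; right; exact ⟨h.1, rfl, fun _ => rfl⟩
  · rintro (h | h | h | h)
    · exact Or.inl ⟨_, h⟩
    · exact Or.inr (Or.inl ⟨_, _, _, h⟩)
    · exact Or.inr (Or.inr (Or.inl ⟨_, _, h⟩))
    · exact Or.inr (Or.inr (Or.inr ⟨_, _, h⟩))

/-- A structure embedded into a model of `𝔨_κ` is a model of `𝔨_κ` if it contains, for each of its
theories, a truth assignment for that theory. -/
theorem IsModel.of_embedding (f : M ↪[lang κ] N) (h : IsModel κ hκ N)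
    (honto : ∀ t : M, Is κ .I t → ∃ s : M, Is κ .J s ∧ Fκ κ s = t) : IsModel κ hκ M where
  partition x := by simpa only [is_map] using h.partition (f x)
  c_mem i := by rw [← is_map f, ← c_map f]; exact h.c_mem i
  c_inj i j hij := h.c_inj (by rw [c_map f, c_map f, hij])
  F_mem i φ hφ := by
    rw [← is_map f, ← F_map f]; exact h.F_mem i _ ((is_map f _ _).2 hφ)
  F_off i x hx := f.injective (by
    rw [← F_map f]; exact h.F_off i _ (fun h' => hx ((is_map f _ _).1 h')))
  form φ hφ := by
    have := h.form (f φ) ((is_map f _ _).2 hφ)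
    rw [form_iff] at this ⊢
    simpa only [F_map, codesVar_map, codesAnd_map, codesNot_map, codesConj_map] using this
  ext φ ψ hφ hψ hh := f.injective (h.ext _ _ ((is_map f _ _).2 hφ) ((is_map f _ _).2 hψ)
    (fun i => by rw [F_map f, F_map f, hh i]))
  R₁_sub φ t ht := by simpa only [is_map] using h.R₁_sub (f φ) (f t) ((R₁_map f _ _).2 ht)
  R₂_sub φ t ht := by simpa only [is_map] using h.R₂_sub (f φ) (f t) ((R₂_map f _ _).2 ht)
  true_var φ s p hφ hs hc := by
    simpa only [R₂_map] using h.true_var (f φ) (f s) (f p) ((is_map f _ _).2 hφ)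
      ((is_map f _ _).2 hs) ((codesVar_map f _ _).2 hc)
  true_and φ s r p q hφ hs hc := by
    simpa only [R₂_map] using h.true_and (f φ) (f s) (f r) (f p) (f q) ((is_map f _ _).2 hφ)
      ((is_map f _ _).2 hs) ((codesAnd_map f _ _ _ _).2 hc)
  true_not φ s q p hφ hs hc := by
    simpa only [R₂_map] using h.true_not (f φ) (f s) (f q) (f p) ((is_map f _ _).2 hφ)
      ((is_map f _ _).2 hs) ((codesNot_map f _ _ _).2 hc)
  true_conj φ s q p hφ hs hc := by
    simpa only [R₂_map] using h.true_conj (f φ) (f s) (f q) (fun i => f (p i))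
      ((is_map f _ _).2 hφ) ((is_map f _ _).2 hs) ((codesConj_map f _ _ _).2 hc)
  Fκ_mem s hs := by
    rw [← is_map f, ← Fκ_map f]; exact h.Fκ_mem _ ((is_map f _ _).2 hs)
  Fκ_off x hx := f.injective (by
    rw [← Fκ_map f]; exact h.Fκ_off _ (fun h' => hx ((is_map f _ _).1 h')))
  models s φ hs hφ := by
    rw [← R₂_map f]
    exact h.models _ _ ((is_map f _ _).2 hs) (by rw [Fκ_map f, R₁_map f]; exact hφ)
  onto := honto

theorem IsModel.of_equiv (e : M ≃[lang κ] N) (h : IsModel κ hκ M) : IsModel κ hκ N := by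
  refine IsModel.of_embedding e.symm.toEmbedding h fun t ht => ?_
  obtain ⟨s, hs, hst⟩ := h.onto (e.symm.toEmbedding t) ((is_map e.symm.toEmbedding _ _).2 ht)
  refine ⟨e.toEmbedding s, (is_map e.toEmbedding _ _).2 hs, ?_⟩
  rw [Fκ_map, hst]
  exact e.apply_symm_apply t

/-- The union of a chain of models of `𝔨_κ` is a model of `𝔨_κ`. -/
theorem IsModel.of_union {ι : Type u} [LinearOrder ι] [Nonempty ι]
    (S : ι →o (lang κ).Substructure M) (hS : ∀ i, IsModel κ hκ (S i))
    (hcov : ∀ x : M, ∃ i, x ∈ S i) : IsModel κ hκ M := by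
  have one : ∀ x : M, ∃ i, ∃ x' : S i, (S i).subtype x' = x := fun x => by
    obtain ⟨i, hi⟩ := hcov x
    exact ⟨i, ⟨x, hi⟩, rfl⟩
  have two : ∀ x y : M, ∃ i, ∃ x' y' : S i, (S i).subtype x' = x ∧ (S i).subtype y' = y :=
    fun x y => by
    obtain ⟨i, hi⟩ := hcov x
    obtain ⟨j, hj⟩ := hcov y
    exact ⟨max i j, ⟨x, S.monotone (le_max_left i j) hi⟩, ⟨y, S.monotone (le_max_right i j) hj⟩,
      rfl, rfl⟩
  refine ⟨?_, ?_, ?_, ?_, ?_, ?_, ?_, ?_, ?_, ?_, ?_, ?_, ?_, ?_, ?_, ?_, ?_⟩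
  · intro x
    obtain ⟨i, x, rfl⟩ := one x
    simpa only [is_map] using (hS i).partition x
  · intro j
    obtain ⟨i⟩ := ‹Nonempty ι›
    rw [c_map (S i).subtype, is_map]
    exact (hS i).c_mem j
  · intro j k hjk
    obtain ⟨i⟩ := ‹Nonempty ι›
    rw [c_map (S i).subtype, c_map (S i).subtype] at hjk
    exact (hS i).c_inj ((S i).subtype.injective hjk)
  · intro j x hx
    obtain ⟨i, x, rfl⟩ := one x
    rw [is_map] at hx
    rw [F_map, is_map]
    exact (hS i).F_mem j x hx
  · intro j x hx
    obtain ⟨i, x, rfl⟩ := one x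
    rw [is_map] at hx
    rw [F_map, (hS i).F_off j x hx]
  · intro x hx
    obtain ⟨i, x, rfl⟩ := one x
    rw [is_map] at hx
    have := (hS i).form x hx
    rw [form_iff] at this ⊢
    simpa only [F_map, codesVar_map, codesAnd_map, codesNot_map, codesConj_map] using this
  · intro x y hx hy h
    obtain ⟨i, x, y, rfl, rfl⟩ := two x y
    rw [is_map] at hx hy
    simp only [F_map, (S i).subtype.injective.eq_iff] at h
    rw [(hS i).ext x y hx hy h]
  · intro x y h
    obtain ⟨i, x, y, rfl, rfl⟩ := two x y
    rw [R₁_map] at h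
    simpa only [is_map] using (hS i).R₁_sub x y h
  · intro x y h
    obtain ⟨i, x, y, rfl, rfl⟩ := two x y
    rw [R₂_map] at h
    simpa only [is_map] using (hS i).R₂_sub x y h
  · intro x y p hx hy h
    obtain ⟨i, x, y, rfl, rfl⟩ := two x y
    rw [is_map] at hx hy
    obtain rfl : (S i).subtype (F (idx hκ 1) x) = p := by rw [← F_map, h.2 _ le_rfl]
    rw [codesVar_map] at h
    simpa only [R₂_map] using (hS i).true_var x y _ hx hy h
  · intro x y r p q hx hy h
    obtain ⟨i, x, y, rfl, rfl⟩ := two x y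
    rw [is_map] at hx hy
    obtain rfl : (S i).subtype (F (idx hκ 1) x) = p := by rw [← F_map, h.2.1]
    obtain rfl : (S i).subtype (F (idx hκ 2) x) = q := by rw [← F_map, h.2.2.1]
    obtain rfl : (S i).subtype (F (idx hκ 3) x) = r := by rw [← F_map, h.2.2.2 _ le_rfl]
    rw [codesAnd_map] at h
    simpa only [R₂_map] using (hS i).true_and x y _ _ _ hx hy h
  · intro x y q p hx hy h
    obtain ⟨i, x, y, rfl, rfl⟩ := two x y
    rw [is_map] at hx hy
    obtain rfl : (S i).subtype (F (idx hκ 1) x) = p := by rw [← F_map, h.2.1]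
    obtain rfl : (S i).subtype (F (idx hκ 2) x) = q := by rw [← F_map, h.2.2 _ le_rfl]
    rw [codesNot_map] at h
    simpa only [R₂_map] using (hS i).true_not x y _ _ hx hy h
  · intro x y q p hx hy h
    obtain ⟨i, x, y, rfl, rfl⟩ := two x y
    rw [is_map] at hx hy
    obtain rfl : (S i).subtype (F (idx hκ 1) x) = q := by rw [← F_map, h.2.1]
    obtain rfl : (fun j => (S i).subtype (F j.1 x)) = p := by
      funext j; rw [← F_map, h.2.2 j]
    rw [codesConj_map] at h
    simpa only [R₂_map] using (hS i).true_conj x y _ _ hx hy h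
  · intro x hx
    obtain ⟨i, x, rfl⟩ := one x
    rw [is_map] at hx
    rw [Fκ_map, is_map]
    exact (hS i).Fκ_mem x hx
  · intro x hx
    obtain ⟨i, x, rfl⟩ := one x
    rw [is_map] at hx
    rw [Fκ_map, (hS i).Fκ_off x hx]
  · intro x y hx h
    obtain ⟨i, x, y, rfl, rfl⟩ := two x y
    rw [is_map] at hx
    rw [Fκ_map, R₁_map] at h
    rw [R₂_map]
    exact (hS i).models x y hx h
  · intro x hx
    obtain ⟨i, x, rfl⟩ := one x
    rw [is_map] at hx
    obtain ⟨s, hs, hst⟩ := (hS i).onto x hx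
    exact ⟨(S i).subtype s, (is_map _ _ _).2 hs, by rw [Fκ_map, hst]⟩

theorem card_functions_le (hκ : ℵ₀ ≤ κ) : #(Σ n, (lang κ).Functions n) ≤ κ := by
  let e : (Σ n, Func κ n) → (κ.ord.ToType ⊕ Unit) ⊕ κ.ord.ToType := fun x =>
    match x with
    | ⟨_, .F i⟩ => .inl (.inl i)
    | ⟨_, .Fκ⟩ => .inl (.inr ())
    | ⟨_, .c i⟩ => .inr i
  have he : Function.Injective e := by
    rintro ⟨_, _ | _ | _⟩ ⟨_, _ | _ | _⟩ h <;> simp_all [e]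
  refine (Cardinal.mk_le_of_injective he).trans ?_
  have h1 : (1 : Cardinal.{u}) ≤ κ := Cardinal.one_le_aleph0.trans hκ
  simp only [Cardinal.mk_sum, Cardinal.mk_ord_toType, Cardinal.lift_id, Cardinal.lift_uzero,
    Cardinal.mk_fintype, Fintype.card_unit, Nat.cast_one, Cardinal.lift_one]
  rw [Cardinal.add_eq_left hκ h1, Cardinal.add_eq_self hκ]

/-- The Löwenheim–Skolem–Tarski property of `𝔨_κ`. -/
theorem IsModel.exists_small (h : IsModel κ hκ M) (A : Set M) :
    ∃ S : (lang κ).Substructure M, A ⊆ S ∧ IsModel κ hκ S ∧ #S ≤ #A + κ := by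
  classical
  have hw : ∀ t : M, ∃ s : M, Is κ .I t → Is κ .J s ∧ Fκ κ s = t := fun t => by
    by_cases ht : Is κ .I t
    · obtain ⟨s, hs⟩ := h.onto t ht
      exact ⟨s, fun _ => hs⟩
    · exact ⟨t, fun h' => absurd h' ht⟩
  choose W hW using hw
  let A₁ : (lang κ).Substructure M := Substructure.closure (lang κ) A
  let B : Set M := W '' {t | t ∈ A₁ ∧ Is κ .I t}
  have hB : ∀ x ∈ B, Is κ .J x ∧ Fκ κ x ∈ A₁ := by
    rintro _ ⟨t, ⟨ht, hI⟩, rfl⟩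
    obtain ⟨h1, h2⟩ := hW t hI
    exact ⟨h1, by rw [h2]; exact ht⟩
  let S : (lang κ).Substructure M :=
    { carrier := (A₁ : Set M) ∪ B
      fun_mem := by
        intro n g x hx
        cases g with
        | F i =>
          have hx0 : x = ![x 0] := by ext j; fin_cases j; rfl
          rcases hx 0 with h0 | h0
          · exact Or.inl (A₁.fun_mem (Func.F i : (lang κ).Functions 1) x (fun j => by
              fin_cases j; exact h0))
          · have hn : ¬ Is κ .Γ (x 0) := fun hΓ => by
              have := (h.partition (x 0)).unique hΓ (hB _ h0).1
              cases this
            have := h.F_off i (x 0) hn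
            rw [hx0]
            change F i (x 0) ∈ _
            rw [this]
            exact Or.inr h0
        | Fκ =>
          have hx0 : x = ![x 0] := by ext j; fin_cases j; rfl
          rcases hx 0 with h0 | h0
          · exact Or.inl (A₁.fun_mem (Func.Fκ : (lang κ).Functions 1) x (fun j => by
              fin_cases j; exact h0))
          · rw [hx0]
            exact Or.inl (hB _ h0).2
        | c i =>
          exact Or.inl (A₁.fun_mem (Func.c i : (lang κ).Functions 0) x (fun j => j.elim0)) }
  have hAS : A ⊆ S := fun x hx => Or.inl (Substructure.subset_closure hx)
  refine ⟨S, hAS, IsModel.of_embedding S.subtype h ?_, ?_⟩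
  · rintro ⟨t, ht⟩ hI
    have hI' : Is κ .I t := (is_map S.subtype _ ⟨t, ht⟩).2 hI
    have htA : t ∈ A₁ := by
      rcases ht with ht | ht
      · exact ht
      · have := (h.partition t).unique hI' (hB _ ht).1
        cases this
    obtain ⟨h1, h2⟩ := hW t hI'
    have hWS : W t ∈ S := Or.inr ⟨t, ⟨htA, hI'⟩, rfl⟩
    refine ⟨⟨W t, hWS⟩, (is_map S.subtype _ ⟨W t, hWS⟩).1 h1, S.subtype.injective ?_⟩
    rw [← Fκ_map]
    exact h2
  · have hA₁ : #A₁ ≤ #A + κ := by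
      have := Substructure.lift_card_closure_le (L := lang κ) (s := A)
      simp only [Cardinal.lift_id] at this
      refine this.trans (max_le (hκ.trans (self_le_add_left _ _)) ?_)
      gcongr
      exact card_functions_le hκ
    have hBc : #B ≤ #A₁ :=
      Cardinal.mk_image_le.trans (Cardinal.mk_le_mk_of_subset fun x hx => hx.1)
    have hinf : ℵ₀ ≤ #A + κ := hκ.trans (self_le_add_left _ _)
    calc #S = #((A₁ : Set M) ∪ B : Set M) := rfl
      _ ≤ #A₁ + #B := Cardinal.mk_union_le _ _
      _ ≤ (#A + κ) + (#A + κ) := add_le_add hA₁ (hBc.trans hA₁)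
      _ = #A + κ := Cardinal.add_eq_self hinf

end lemmas

/-- The abstract elementary class `𝔨_κ`; here `M ≤ N` means that `M` is a substructure of `N` and
both are in the class. -/
def frakK (κ : Cardinal.{u}) (hκ : ℵ₀ ≤ κ) : AEC.{u, u, 0} (lang κ) where
  Mem M _ := IsModel κ hκ M
  Strong {M N} _ _ _ := IsModel κ hκ M ∧ IsModel κ hκ N
  mem_left _ h := h.1
  mem_right _ h := h.2
  iso e h := ⟨h.of_equiv e, h, h.of_equiv e⟩
  comp _ _ hg hf := ⟨hf.1, hg.2⟩
  coherence _ _ hg hgf := ⟨hgf.1, hg.1⟩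
  union S hS hcov := by
    have hS' := fun i => (hS i i le_rfl).1
    have hM := IsModel.of_union S hS' hcov
    exact ⟨hM, fun i => ⟨hS' i, hM⟩, fun _ hf => ⟨hM, (hf (Classical.arbitrary _)).2⟩⟩
  exists_LST := ⟨κ, hκ, fun M _ h A => by
    obtain ⟨S, h1, h2, h3⟩ := h.exists_small A
    exact ⟨S, h1, ⟨h2, h⟩, h3⟩⟩

end PropAEC

/-- The ultrafilter `D` on `X` is uniform: all its members have the cardinality of `X`. -/
def Ultrafilter.IsUniform {X : Type u} (D : Ultrafilter X) : Prop :=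
  ∀ A ∈ D, #A = #X

namespace PropAEC

/-! A truth assignment on the variables `P = 𝒫(θ)` is a family `D` of subsets of `θ`. If it
satisfies every sentence `(Aᶜ ≡ ¬ A)` and `(⋂ A_i ≡ ⋀ A_i)`, then `D` is a `κ⁺`-complete
ultrafilter; if it also satisfies `(A)` for each final segment `A`, then `D` is uniform, by
regularity of `θ`. The hypothesis on `θ` thus says that these sentences have no common model.
Initial pieces of this theory do have models: each of the sentences is true in the principal
assignments at all large enough `j < θ`.

Accordingly, let `M_i` consist of all variables and of the sentences that are true at every `j ≥ k`
for some `k < i`, with no theories or assignments. Adding one theory that contains all the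
sentences, together with the principal assignments at `j ≥ i`, gives an extension of `M_i` in the
class (`isModel_sub`). The types of the added theories cohere (`tp_ext_restrict`). Containing all
sentences of the base model is an invariant of the type (`PointedExt.isFullTheory_iff_of_tp_eq`), so
a type over `M_θ` extending them all is realized by a theory containing every sentence of `M_θ`. As
`F_κ` is onto, some assignment satisfies that theory, and `exists_ultrafilter_of_isFullTheory` turns
it into the forbidden ultrafilter. The models have size at most `2^θ` by `mk_le`. -/

theorem idx_injective {κ : Cardinal.{u}} (hκ : ℵ₀ ≤ κ) : Function.Injective (idx hκ) := by
  intro m n h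
  simpa [idx, Subtype.ext_iff] using h

theorem idx_strictMono {κ : Cardinal.{u}} (hκ : ℵ₀ ≤ κ) : StrictMono (idx hκ) := by
  intro m n h
  simpa [idx, ← Subtype.coe_lt_coe] using h

/-! ### Principal truth assignments

The propositional variables are the subsets of `θ`, the variable `A` being true at `j` iff
`j ∈ A`. The constants are given by an embedding of `κ` into `θ`, as singletons. -/

section ambient

variable {κ θ : Cardinal.{u}} (hκ : ℵ₀ ≤ κ) (e : κ.ord.ToType ↪ θ.ord.ToType)

/-- The sequence `f` of variables is a sentence of one of the four forms. -/
def IsSentence (f : κ.ord.ToType → Set θ.ord.ToType) : Prop :=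
  (f (idx hκ 0) = {e (idx hκ 0)} ∧ ∀ i, idx hκ 1 ≤ i → f i = f (idx hκ 1)) ∨
  (f (idx hκ 0) = {e (idx hκ 1)} ∧ ∀ i, idx hκ 3 ≤ i → f i = f (idx hκ 3)) ∨
  (f (idx hκ 0) = {e (idx hκ 2)} ∧ ∀ i, idx hκ 2 ≤ i → f i = f (idx hκ 2)) ∨
  f (idx hκ 0) = {e (idx hκ 3)}

/-- The sentence `f` is true in the principal truth assignment at `j`. -/
def Sat (f : κ.ord.ToType → Set θ.ord.ToType) (j : θ.ord.ToType) : Prop :=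
  (f (idx hκ 0) = {e (idx hκ 0)} → j ∈ f (idx hκ 1)) ∧
  (f (idx hκ 0) = {e (idx hκ 1)} →
    (j ∈ f (idx hκ 3) ↔ j ∈ f (idx hκ 1) ∧ j ∈ f (idx hκ 2))) ∧
  (f (idx hκ 0) = {e (idx hκ 2)} → (j ∈ f (idx hκ 2) ↔ j ∉ f (idx hκ 1))) ∧
  (f (idx hκ 0) = {e (idx hκ 3)} → (j ∈ f (idx hκ 1) ↔ ∀ i, idx hκ 2 ≤ i → j ∈ f i))

/-- The constants tagging the four forms stay distinct in the ambient structure, so at most one of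
the four implications in `Sat` is not vacuous. -/
theorem singleton_idx_eq_iff (m n : ℕ) :
    ({e (idx hκ m)} : Set θ.ord.ToType) = {e (idx hκ n)} ↔ m = n := by
  rw [Set.singleton_eq_singleton_iff, e.injective.eq_iff, (idx_injective hκ).eq_iff]

/-- The universe of the ambient structure: all variables, all sentences, one theory, and the
principal truth assignments. -/
inductive Ambient : Type u
  | var (A : Set θ.ord.ToType)
  | sent (f : {f : κ.ord.ToType → Set θ.ord.ToType // IsSentence hκ e f})
  | thy
  | asg (j : θ.ord.ToType)

namespace Ambient

variable {hκ e}

/-- The sort of an element. -/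
def kind : Ambient hκ e → Kind
  | .var _ => .P
  | .sent _ => .Γ
  | .thy => .I
  | .asg _ => .J

/-- The values of `F_i`. -/
def const (i : κ.ord.ToType) : Ambient hκ e → Ambient hκ e
  | .sent f => var (f.1 i)
  | x => x

/-- The values of `F_κ`. -/
def theory : Ambient hκ e → Ambient hκ e
  | .asg _ => thy
  | x => x

/-- Truth at the principal truth assignment `j`. -/
def Holds : Ambient hκ e → θ.ord.ToType → Prop
  | .var A, j => j ∈ A
  | .sent f, j => Sat hκ e f.1 j
  | _, _ => False

/-- All sentences belong to the theory `thy`. -/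
instance : (lang κ).Structure (Ambient hκ e) where
  funMap {_} g x := match g, x with
    | .F i, x => (x 0).const i
    | .Fκ, x => (x 0).theory
    | .c i, _ => var {e i}
  RelMap {_} r x := match r, x with
    | .kind k, x => (x 0).kind = k
    | .R₁, x => (x 0).kind = .Γ ∧ x 1 = thy
    | .R₂, x => ∃ j, x 1 = asg j ∧ (x 0).Holds j

@[simp] theorem is_iff (k : Kind) (x : Ambient hκ e) : Is κ k x ↔ x.kind = k := Iff.rfl

@[simp] theorem R₁_iff (x t : Ambient hκ e) : R₁ κ x t ↔ x.kind = .Γ ∧ t = thy := Iff.rfl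

@[simp] theorem R₂_iff (x s : Ambient hκ e) : R₂ κ x s ↔ ∃ j, s = asg j ∧ x.Holds j := Iff.rfl

@[simp] theorem F_eq (i : κ.ord.ToType) (x : Ambient hκ e) : F i x = x.const i := rfl

@[simp] theorem Fκ_eq (x : Ambient hκ e) : Fκ κ x = x.theory := rfl

@[simp] theorem c_eq (i : κ.ord.ToType) : c (Ambient hκ e) i = var {e i} := rfl

/-- The sentences which are true at all `j ≥ k`, for some `k < i`. -/
def EventuallyTrue (i : Ordinal.{u}) (f : κ.ord.ToType → Set θ.ord.ToType) : Prop :=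
  ∃ k : θ.ord.ToType, (k : Ordinal.{u}) < i ∧ ∀ j, k ≤ j → Sat hκ e f j

/-- The elements of the ambient structure which belong to `Ambient.sub i X`. -/
def Mem (i : Ordinal.{u}) (X : Set θ.ord.ToType) : Ambient hκ e → Prop
  | .var _ => True
  | .sent f => EventuallyTrue (hκ := hκ) (e := e) i f.1
  | .thy => X.Nonempty
  | .asg j => j ∈ X

variable (hκ e) in
/-- The substructure of the ambient structure with all variables, those sentences which are true
at all `j ≥ k` for some `k < i`, the truth assignments in `X`, and the theory if `X` is
nonempty. -/
def sub (i : Ordinal.{u}) (X : Set θ.ord.ToType) : (lang κ).Substructure (Ambient hκ e) where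
  carrier := {x | x.Mem i X}
  fun_mem := by
    intro n g x hx
    cases g with
    | F m =>
      have h0 : (x 0).Mem i X := hx 0
      change ((x 0).const m).Mem i X
      cases h : x 0 <;> simp_all [const, Mem]
    | Fκ =>
      have h0 : (x 0).Mem i X := hx 0
      change ((x 0).theory).Mem i X
      cases h : x 0 with
      | asg j => rw [h] at h0; exact ⟨j, h0⟩
      | _ => rwa [h] at h0
    | c m => trivial

theorem mem_sub {i : Ordinal.{u}} {X : Set θ.ord.ToType} {x : Ambient hκ e} :
    x ∈ sub hκ e i X ↔ x.Mem i X := Iff.rfl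

theorem sub_mono {i j : Ordinal.{u}} {X Y : Set θ.ord.ToType} (hij : i ≤ j) (hXY : X ⊆ Y) :
    sub hκ e i X ≤ sub hκ e j Y := by
  intro x hx
  rw [mem_sub] at hx ⊢
  cases x with
  | var A => trivial
  | sent f => exact hx.imp fun k hk => ⟨hk.1.trans_le hij, hk.2⟩
  | thy => exact hx.mono hXY
  | asg j => exact hXY hx

/-- The sentences at stage `i` have thresholds below `i`, so every principal assignment from `i` on
satisfies all of them at once. -/
theorem holds_of_eventuallyTrue {i : Ordinal.{u}} {f : κ.ord.ToType → Set θ.ord.ToType}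
    (hf : EventuallyTrue (hκ := hκ) (e := e) i f) {j : θ.ord.ToType} (hj : i ≤ (j : Ordinal.{u})) :
    Sat hκ e f j := by
  obtain ⟨k, hk, h⟩ := hf
  refine h j ?_
  have : (k : Ordinal.{u}) ≤ (j : Ordinal.{u}) := hk.le.trans hj
  simpa using this

/-- A structure embedded into the ambient structure is a model of `𝔨_κ` if its truth assignments
satisfy all its sentences, and there is a truth assignment if there is a theory. -/
theorem isModel_of_embedding {M : Type u} [(lang κ).Structure M] (f : M ↪[lang κ] Ambient hκ e)
    (hon : ∀ t : M, f t = thy → ∃ s : M, (f s).kind = .J)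
    (hmod : ∀ (φ s : M) j, (f φ).kind = .Γ → f s = asg j → (f φ).Holds j) : IsModel κ hκ M := by
  have hΓ : ∀ {x : Ambient hκ e}, Is κ .Γ x → ∃ g, x = sent g := by
    rintro (_ | _ | _ | _) h <;> simp_all [kind]
  have hJ : ∀ {x : Ambient hκ e}, Is κ .J x → ∃ j, x = asg j := by
    rintro (_ | _ | _ | _) h <;> simp_all [kind]
  have hI : ∀ {x : Ambient hκ e}, Is κ .I x → x = thy := by
    rintro (_ | _ | _ | _) h <;> simp_all [kind]
  have hs := singleton_idx_eq_iff hκ e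
  refine ⟨?_, ?_, ?_, ?_, ?_, ?_, ?_, ?_, ?_, ?_, ?_, ?_, ?_, ?_, ?_, ?_, ?_⟩
  · intro x
    simp only [← is_map f, is_iff]
    exact ⟨_, rfl, fun _ h => h.symm⟩
  · intro i
    rw [← is_map f, ← c_map f]
    rfl
  · intro i j hij
    have : c (Ambient hκ e) i = c (Ambient hκ e) j := by rw [c_map f, c_map f, hij]
    simpa using this
  · intro i φ hφ
    rw [← is_map f] at hφ ⊢
    rw [← F_map f]
    obtain ⟨g, hg⟩ := hΓ hφ
    simp [hg, const, kind]
  · intro i x hx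
    rw [← is_map f] at hx
    apply f.injective
    rw [← F_map f]
    cases h : f x <;> simp_all [const, kind]
  · intro φ hφ
    rw [← is_map f] at hφ
    obtain ⟨g, hg⟩ := hΓ hφ
    -- The constituents of a sentence are its own values `F_i`, hence lie in `M`; the form can
    -- therefore be read off in the ambient structure.
    rw [form_iff]
    simp only [← codesVar_map f, ← codesAnd_map f, ← codesNot_map f, ← codesConj_map f, ← F_map f,
      hg]
    rcases g.2 with h | h | h | h
    · left
      exact ⟨congrArg var h.1, fun i hi => congrArg var (h.2 i hi)⟩
    · right; left
      exact ⟨congrArg var h.1, rfl, rfl, fun i hi => congrArg var (h.2 i hi)⟩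
    · right; right; left
      exact ⟨congrArg var h.1, rfl, fun i hi => congrArg var (h.2 i hi)⟩
    · right; right; right
      exact ⟨congrArg var h, rfl, fun i => rfl⟩
  · intro φ ψ hφ hψ h
    rw [← is_map f] at hφ hψ
    obtain ⟨g, hg⟩ := hΓ hφ
    obtain ⟨g', hg'⟩ := hΓ hψ
    apply f.injective
    rw [hg, hg', sent.injEq, Subtype.ext_iff]
    funext i
    have := congrArg f (h i)
    rw [← F_map, ← F_map, hg, hg'] at this
    simpa [const] using this
  · intro x y h
    rw [← R₁_map f, R₁_iff] at h
    rw [← is_map f, ← is_map f]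
    exact ⟨h.1, by rw [h.2]; rfl⟩
  · intro x y h
    rw [← R₂_map f, R₂_iff] at h
    obtain ⟨j, hj, hx⟩ := h
    simp only [← is_map f, hj]
    cases h : f x <;> simp_all [Holds, kind]
  · intro φ s p hφ hs' h
    rw [← is_map f] at hφ hs'
    obtain ⟨g, hg⟩ := hΓ hφ
    obtain ⟨j, hj⟩ := hJ hs'
    rw [← codesVar_map f, hg] at h
    have h0 : g.1 (idx hκ 0) = _ := var.inj h.1
    have h1 : var (g.1 (idx hκ 1)) = _ := h.2 _ le_rfl
    simp [← R₂_map f, hg, hj, ← h1, Holds, Sat, h0, hs]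
  · intro φ s r p q hφ hs' h
    rw [← is_map f] at hφ hs'
    obtain ⟨g, hg⟩ := hΓ hφ
    obtain ⟨j, hj⟩ := hJ hs'
    rw [← codesAnd_map f, hg] at h
    have h0 : g.1 (idx hκ 0) = _ := var.inj h.1
    have h1 : var (g.1 (idx hκ 1)) = _ := h.2.1
    have h2 : var (g.1 (idx hκ 2)) = _ := h.2.2.1
    have h3 : var (g.1 (idx hκ 3)) = _ := h.2.2.2 _ le_rfl
    simp [← R₂_map f, hg, hj, ← h1, ← h2, ← h3, Holds, Sat, h0, hs]
  · intro φ s q p hφ hs' h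
    rw [← is_map f] at hφ hs'
    obtain ⟨g, hg⟩ := hΓ hφ
    obtain ⟨j, hj⟩ := hJ hs'
    rw [← codesNot_map f, hg] at h
    have h0 : g.1 (idx hκ 0) = _ := var.inj h.1
    have h1 : var (g.1 (idx hκ 1)) = _ := h.2.1
    have h2 : var (g.1 (idx hκ 2)) = _ := h.2.2 _ le_rfl
    simp [← R₂_map f, hg, hj, ← h1, ← h2, Holds, Sat, h0, hs]
  · intro φ s q p hφ hs' h
    rw [← is_map f] at hφ hs'
    obtain ⟨g, hg⟩ := hΓ hφ
    obtain ⟨j, hj⟩ := hJ hs'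
    rw [← codesConj_map f, hg] at h
    have h0 : g.1 (idx hκ 0) = _ := var.inj h.1
    have h1 : var (g.1 (idx hκ 1)) = _ := h.2.1
    have h2 : ∀ i, var (g.1 i.1) = f (p i) := h.2.2
    simp [← R₂_map f, hg, hj, ← h1, ← h2, Holds, Sat, h0, hs]
  · intro s hs'
    rw [← is_map f] at hs' ⊢
    obtain ⟨j, hj⟩ := hJ hs'
    rw [← Fκ_map, hj]
    rfl
  · intro x hx
    rw [← is_map f] at hx
    apply f.injective
    rw [← Fκ_map f]
    cases h : f x <;> simp_all [theory, kind]
  · intro s φ hs' h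
    rw [← is_map f] at hs'
    rw [← R₁_map f] at h
    obtain ⟨j, hj⟩ := hJ hs'
    rw [← R₂_map f, R₂_iff]
    exact ⟨j, hj, hmod φ s j h.1 hj⟩
  · intro t ht
    rw [← is_map f] at ht
    obtain ⟨s, hs'⟩ := hon t (hI ht)
    obtain ⟨j, hj⟩ := hJ hs'
    refine ⟨s, (is_map f _ _).1 hs', f.injective ?_⟩
    rw [← Fκ_map, hj, hI ht]
    rfl

/-- Only satisfaction and surjectivity of `F_κ` need an argument: assignments in `X` lie beyond the
thresholds of all sentences present, and the theory is present only when `X` supplies an assignment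
for it. -/
theorem isModel_sub {i : Ordinal.{u}} {X : Set θ.ord.ToType}
    (hX : ∀ j ∈ X, i ≤ (j : Ordinal.{u})) : IsModel κ hκ (sub hκ e i X) := by
  refine isModel_of_embedding (sub hκ e i X).subtype ?_ ?_
  · rintro ⟨t, ht⟩ rfl
    obtain ⟨j, hj⟩ : X.Nonempty := ht
    exact ⟨⟨asg j, hj⟩, rfl⟩
  · rintro ⟨φ, hφ⟩ ⟨s, hs⟩ j h1 rfl
    cases φ with
    | sent f => exact holds_of_eventuallyTrue hφ (hX j hs)
    | _ => cases h1

/-- The sentences dominate the count: they are `κ`-sequences of subsets of `θ`, and `(2^θ)^κ = 2^θ`.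
-/
theorem mk_le (hκθ : κ ≤ θ) : #(Ambient hκ e) ≤ 2 ^ θ := by
  have hθ : ℵ₀ ≤ θ := hκ.trans hκθ
  let g : Ambient hκ e → (Set θ.ord.ToType × (κ.ord.ToType → Set θ.ord.ToType)) ×
      (Bool × Bool) := fun x => match x with
    | .var A => ((A, fun _ => ∅), (true, true))
    | .sent f => ((∅, f.1), (true, false))
    | .thy => ((∅, fun _ => ∅), (false, true))
    | .asg j => (({j}, fun _ => ∅), (false, false))
  have hg : Function.Injective g := by
    rintro (_ | _ | _ | _) (_ | _ | _ | _) h <;> simp_all [g, Subtype.ext_iff]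
  have h2 : ℵ₀ ≤ (2 : Cardinal.{u}) ^ θ := hθ.trans (cantor θ).le
  refine (mk_le_of_injective hg).trans ?_
  simp only [mk_prod, mk_set, mk_pi, prod_const, mk_ord_toType, lift_id, ← power_mul,
    mul_eq_left hθ hκθ (aleph0_pos.trans_le hκ).ne', mul_eq_self h2]
  refine mul_le_of_le h2 (by simp) ?_
  have h3 : (2 : Cardinal.{u}) ≤ 2 ^ θ := (natCast_lt_aleph0 (n := 2)).le.trans h2
  simpa using mul_le_of_le h2 h3 h3

end Ambient

end ambient

end PropAEC

namespace PropAEC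

/-! ### The type of a theory containing all sentences -/

section types

variable {κ : Cardinal.{u}} {hκ : ℵ₀ ≤ κ} {M : Type u} [(lang κ).Structure M]

/-- `x` realizes the type of a theory containing all sentences of `M`. -/
def PointedExt.IsFullTheory (x : (frakK κ hκ).PointedExt M) : Prop :=
  ∃ t, x.tuple = [t] ∧ Is κ .I t ∧ ∀ φ : M, Is κ .Γ φ → R₁ κ (x.emb φ) t

/-- Embeddings over `M` preserve and reflect `I` and `R₁`. Both directions are needed, since
equality of types comes from zigzags of steps. -/
theorem PointedExt.isFullTheory_iff {x y : (frakK κ hκ).PointedExt M}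
    (h : (frakK κ hκ).Step x y) : IsFullTheory x ↔ IsFullTheory y := by
  obtain ⟨g, -, hg, hxy⟩ := h
  have hemb : ∀ φ, y.emb φ = g (x.emb φ) := fun φ => by rw [← hg]; rfl
  constructor
  · rintro ⟨t, ht, hI, hR⟩
    refine ⟨g t, by rw [← hxy, ht]; rfl, (is_map g _ _).2 hI, fun φ hφ => ?_⟩
    rw [hemb, R₁_map]
    exact hR φ hφ
  · rintro ⟨t', ht', hI, hR⟩
    rw [ht'] at hxy
    obtain ⟨t, ht, rfl⟩ := List.map_eq_singleton_iff.1 hxy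
    refine ⟨t, ht, (is_map g _ _).1 hI, fun φ hφ => ?_⟩
    rw [← R₁_map g, ← hemb]
    exact hR φ hφ

theorem PointedExt.isFullTheory_iff_of_tp_eq {x y : (frakK κ hκ).PointedExt M}
    (h : (frakK κ hκ).tp x = (frakK κ hκ).tp y) : IsFullTheory x ↔ IsFullTheory y :=
  iff_of_eq (congrArg
    (Quot.lift IsFullTheory fun _ _ h => propext (PointedExt.isFullTheory_iff h)) h)

end types

/-! ### Ultrafilters from truth assignments -/

section ultrafilter

/-- A conjunction always has exactly `κ` conjuncts, so a smaller nonempty family must be listed with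
repetitions. Removing finitely many indices leaves `κ` of them. -/
theorem exists_surjective_subtype_le_idx {κ : Cardinal.{u}} (hκ : ℵ₀ ≤ κ) (n : ℕ) {α : Type u}
    (S : Set α) (hS : S.Nonempty) (hSκ : #S ≤ κ) :
    ∃ g : {i : κ.ord.ToType // idx hκ n ≤ i} → S, Function.Surjective g := by
  have : Infinite κ.ord.ToType := by rw [infinite_iff, mk_ord_toType]; exact hκ
  have h : #{i : κ.ord.ToType // idx hκ n ≤ i} = κ := by
    have := mk_compl_of_infinite (Iio (idx hκ n))
      (mk_Iio_lt _ (by simp))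
    rw [mk_ord_toType, compl_Iio] at this
    exact this
  rw [← h] at hSκ
  obtain ⟨f⟩ := hSκ
  have := hS.to_subtype
  exact ⟨Function.invFun f, Function.invFun_surjective f.injective⟩

/-- A family of subsets of `X` which contains exactly one of `A` and its complement for each `A`,
and contains the intersection of at most `κ` sets iff it contains each of them, is an
ultrafilter. -/
theorem exists_ultrafilter {κ : Cardinal.{u}} (hκ : ℵ₀ ≤ κ) {X : Type u} (D : Set (Set X))
    (hcompl : ∀ A, Aᶜ ∈ D ↔ A ∉ D)
    (hinter : ∀ S : Set (Set X), S.Nonempty → #S ≤ κ → (⋂₀ S ∈ D ↔ ∀ A ∈ S, A ∈ D)) :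
    ∃ U : Ultrafilter X, (∀ A, A ∈ U ↔ A ∈ D) ∧
      CardinalInterFilter (U : Filter X) (Order.succ κ) := by
  have hpair : ∀ A B, A ∩ B ∈ D ↔ A ∈ D ∧ B ∈ D := fun A B => by
    have := hinter {A, B} (insert_nonempty _ _) ((lt_aleph0_of_finite _).le.trans hκ)
    simpa using this
  have hempty : ∅ ∉ D := fun h => by
    have h2 : Set.univ ∈ D := ((hpair ∅ Set.univ).1 (by simpa using h)).2
    rw [← compl_empty, hcompl] at h2
    exact h2 h
  have huniv : Set.univ ∈ D := by rwa [← compl_empty, hcompl]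
  let F : Filter X :=
    { sets := D
      univ_sets := huniv
      sets_of_superset := fun {A B} hA hAB => ((hpair A B).1 (by
        rwa [inter_eq_self_of_subset_left hAB])).2
      inter_sets := fun {A B} hA hB => (hpair A B).2 ⟨hA, hB⟩ }
  refine ⟨Ultrafilter.ofComplNotMemIff F fun A => (hcompl A).not.trans not_not,
    fun _ => Iff.rfl, ⟨fun S hS hSD => ?_⟩⟩
  -- The hypothesis on intersections covers nonempty families only; the empty one is the whole
  -- space.
  rcases S.eq_empty_or_nonempty with rfl | hne
  · rw [sInter_empty]
    exact huniv
  · exact (hinter S hne (Order.lt_succ_iff.1 hS)).2 hSD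

/-- By regularity a set of fewer than `θ` elements is bounded, hence disjoint from a final segment,
and cannot belong to `U`. -/
theorem isUniform_of_Ici_mem {θ : Cardinal.{u}} (hθ : θ.IsRegular)
    (U : Ultrafilter θ.ord.ToType) (hU : ∀ k, Ici k ∈ U) : U.IsUniform := by
  intro A hA
  rw [mk_ord_toType]
  refine le_antisymm ((mk_set_le A).trans (mk_ord_toType θ).le) (not_lt.1 fun hlt => ?_)
  have hc : ¬ IsCofinal A := fun hc => by
    have := (Order.cof_le hc).trans_lt hlt
    rw [Ordinal.cof_toType, hθ.cof_ord] at this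
    exact this.false
  obtain ⟨k, hk⟩ : ∃ k, ∀ a ∈ A, ¬ k ≤ a := by simpa [IsCofinal] using hc
  have : Ici k ∩ A = ∅ := by
    ext a
    simpa using fun h h' => hk a h' h
  exact U.empty_notMem (this ▸ U.inter_mem (hU k) hA)

end ultrafilter

/-! ### The chain of models, its coherent types, and the ultrafilter from a limit type -/

namespace Ambient

variable {κ θ : Cardinal.{u}} {hκ : ℵ₀ ≤ κ} {e : κ.ord.ToType ↪ θ.ord.ToType}

theorem strong_inclusion {i j : Ordinal.{u}} {X Y : Set θ.ord.ToType}
    (hX : ∀ k ∈ X, i ≤ (k : Ordinal.{u})) (hY : ∀ k ∈ Y, j ≤ (k : Ordinal.{u}))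
    (h : sub hκ e i X ≤ sub hκ e j Y) : (frakK κ hκ).Strong (Substructure.inclusion h) :=
  ⟨isModel_sub hX, isModel_sub hY⟩

variable (hκ e) in
/-- The sequence of the models without theories and truth assignments. -/
def chain : (frakK κ hκ).Chain θ.ord where
  carrier := Ambient hκ e
  sub := ⟨fun i => sub hκ e i ∅, fun _ _ h => sub_mono h subset_rfl⟩
  strong _ _ _ := strong_inclusion (by simp) (by simp) _
  continuous i hi x hx := by
    cases x with
    | var A =>
      -- All variables are already in the model with index `0`.
      exact ⟨⟨0, mem_Iic.2 zero_le⟩, by simpa [← Subtype.coe_lt_coe] using hi.bot_lt, trivial⟩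
    | sent f =>
      obtain ⟨k, hk, h⟩ : EventuallyTrue (i : Ordinal.{u}) f.1 := hx
      -- A sentence with threshold `k` first appears at index `k + 1`, which is still below the
      -- limit `i`.
      have hk' := hi.succ_lt hk
      exact ⟨⟨Order.succ (k : Ordinal.{u}), hk'.le.trans i.2⟩, hk', k, Order.lt_succ _, h⟩
    | thy => exact hx.elim fun _ h => h.elim
    | asg j => exact hx.elim

/-- The extension of the model with index `i` by a theory of all its sentences, and the principal
truth assignments at `k ∈ X`. -/
def ext (i : Ordinal.{u}) (X : Set θ.ord.ToType) (hX : ∀ k ∈ X, i ≤ (k : Ordinal.{u}))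
    (hne : X.Nonempty) : (frakK κ hκ).PointedExt (sub hκ e i ∅) where
  carrier := sub hκ e i X
  emb := Substructure.inclusion (sub_mono le_rfl (empty_subset _))
  strong := strong_inclusion (by simp) hX _
  tuple := [⟨thy, hne⟩]

theorem isFullTheory_ext {i : Ordinal.{u}} {X : Set θ.ord.ToType}
    (hX : ∀ k ∈ X, i ≤ (k : Ordinal.{u})) (hne : X.Nonempty) :
    PointedExt.IsFullTheory (ext (hκ := hκ) (e := e) i X hX hne) := by
  refine ⟨_, rfl, ?_, fun φ hφ => ?_⟩
  · exact (is_map (sub hκ e i X).subtype .I ⟨thy, hne⟩).1 rfl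
  · rw [← is_map (sub hκ e i ∅).subtype] at hφ
    exact (R₁_map (sub hκ e i X).subtype (Substructure.inclusion
      (sub_mono le_rfl (empty_subset _)) φ) ⟨thy, hne⟩).1 ⟨hφ, rfl⟩

/-- Final segments of `θ`. -/
def tail (θ : Cardinal.{u}) (i : Ordinal.{u}) : Set θ.ord.ToType := {k | i ≤ (k : Ordinal.{u})}

theorem tail_nonempty {i : Ordinal.{u}} (hi : i < θ.ord) : (tail θ i).Nonempty :=
  ⟨Ordinal.ToType.mk ⟨i, hi⟩, by simp [tail]⟩

/-- Neither extension need embed in the other by inclusion: one has more assignments, the other more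
sentences, and assignments between `i` and `j` may falsify the new sentences. Their common part `z`,
with the sentences of stage `i` and the assignments from `j` on, embeds in both. -/
theorem tp_ext_restrict {i j : Ordinal.{u}} (hij : i ≤ j) (hj : j < θ.ord) :
    (frakK κ hκ).tp (ext (hκ := hκ) (e := e) i (tail θ i) (fun _ h => h)
        (tail_nonempty (hij.trans_lt hj))) =
      (chain hκ e).restrict hij hj.le
        ((frakK κ hκ).tp (ext j (tail θ j) (fun _ h => h) (tail_nonempty hj))) := by
  have hsub : tail θ j ⊆ tail θ i := fun k hk => hij.trans hk
  have hX : ∀ k ∈ tail θ j, i ≤ (k : Ordinal.{u}) := hsub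
  let z : (frakK κ hκ).PointedExt (sub hκ e i ∅) := ext i (tail θ j) hX (tail_nonempty hj)
  trans (frakK κ hκ).tp z
  · symm
    exact Quot.sound ⟨Substructure.inclusion (sub_mono le_rfl hsub),
      strong_inclusion hX (fun _ h => h) _, rfl, rfl⟩
  · exact Quot.sound ⟨Substructure.inclusion (sub_mono hij subset_rfl),
      strong_inclusion hX (fun _ h => h) _, rfl, rfl⟩

/-- The sentence `(A)`. -/
noncomputable def varSentence (hκ : ℵ₀ ≤ κ) (e : κ.ord.ToType ↪ θ.ord.ToType)
    (A : Set θ.ord.ToType) : κ.ord.ToType → Set θ.ord.ToType :=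
  open Classical in fun i => if i = idx hκ 0 then {e (idx hκ 0)} else A

/-- The sentence `(B ≡ ¬ A)`. -/
noncomputable def notSentence (hκ : ℵ₀ ≤ κ) (e : κ.ord.ToType ↪ θ.ord.ToType)
    (B A : Set θ.ord.ToType) : κ.ord.ToType → Set θ.ord.ToType :=
  open Classical in fun i =>
    if i = idx hκ 0 then {e (idx hκ 2)} else if i = idx hκ 1 then A else B

/-- The sentence `(B ≡ ⋀ g_i)`. -/
noncomputable def conjSentence (hκ : ℵ₀ ≤ κ) (e : κ.ord.ToType ↪ θ.ord.ToType)
    (B : Set θ.ord.ToType) (g : {i : κ.ord.ToType // idx hκ 2 ≤ i} → Set θ.ord.ToType) :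
    κ.ord.ToType → Set θ.ord.ToType :=
  open Classical in fun i =>
    if h : idx hκ 2 ≤ i then g ⟨i, h⟩ else if i = idx hκ 0 then {e (idx hκ 3)} else B

theorem isSentence_varSentence (A : Set θ.ord.ToType) :
    IsSentence hκ e (varSentence hκ e A) := by
  have h : ∀ i, idx hκ 1 ≤ i → i ≠ idx hκ 0 := fun i hi =>
    ((idx_strictMono hκ one_pos).trans_le hi).ne'
  refine Or.inl ⟨by simp [varSentence], fun i hi => ?_⟩
  simp [varSentence, h i hi, h _ le_rfl]

theorem isSentence_notSentence (B A : Set θ.ord.ToType) :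
    IsSentence hκ e (notSentence hκ e B A) := by
  have h : ∀ i, idx hκ 2 ≤ i → i ≠ idx hκ 0 ∧ i ≠ idx hκ 1 := fun i hi =>
    ⟨((idx_strictMono hκ two_pos).trans_le hi).ne',
      ((idx_strictMono hκ one_lt_two).trans_le hi).ne'⟩
  refine Or.inr (Or.inr (Or.inl ⟨by simp [notSentence], fun i hi => ?_⟩))
  simp [notSentence, h i hi, h _ le_rfl]

theorem conjSentence_zero (B : Set θ.ord.ToType)
    (g : {i : κ.ord.ToType // idx hκ 2 ≤ i} → Set θ.ord.ToType) :
    conjSentence hκ e B g (idx hκ 0) = {e (idx hκ 3)} := by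
  simp [conjSentence, (idx_strictMono hκ).le_iff_le]

theorem conjSentence_one (B : Set θ.ord.ToType)
    (g : {i : κ.ord.ToType // idx hκ 2 ≤ i} → Set θ.ord.ToType) :
    conjSentence hκ e B g (idx hκ 1) = B := by
  simp [conjSentence, (idx_strictMono hκ).le_iff_le, (idx_injective hκ).eq_iff]

theorem isSentence_conjSentence (B : Set θ.ord.ToType)
    (g : {i : κ.ord.ToType // idx hκ 2 ≤ i} → Set θ.ord.ToType) :
    IsSentence hκ e (conjSentence hκ e B g) :=
  Or.inr (Or.inr (Or.inr (conjSentence_zero B g)))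

theorem sat_varSentence (A : Set θ.ord.ToType) (j : θ.ord.ToType) :
    Sat hκ e (varSentence hκ e A) j ↔ j ∈ A := by
  simp [Sat, varSentence, singleton_idx_eq_iff hκ e, (idx_injective hκ).eq_iff]

theorem sat_notSentence (A : Set θ.ord.ToType) (j : θ.ord.ToType) :
    Sat hκ e (notSentence hκ e Aᶜ A) j := by
  simp [Sat, notSentence, (idx_injective hκ).eq_iff]

theorem sat_conjSentence (g : {i : κ.ord.ToType // idx hκ 2 ≤ i} → Set θ.ord.ToType)
    (j : θ.ord.ToType) : Sat hκ e (conjSentence hκ e (⋂ i, g i) g) j := by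
  refine ⟨?_, ?_, ?_, fun _ => ?_⟩
  -- The tag is that of a conjunction, so the clauses for the other three forms are vacuous.
  any_goals
    rw [conjSentence_zero, singleton_idx_eq_iff]
    intro h
    omega
  rw [conjSentence_one, mem_iInter, Subtype.forall]
  refine forall_congr' fun i => forall_congr' fun hi => ?_
  simp [conjSentence, hi]

/-- A theory containing all sentences which are eventually true in the principal truth assignments
yields a uniform `κ⁺`-complete ultrafilter. -/
theorem exists_ultrafilter_of_isFullTheory (hθ : θ.IsRegular)
    (x : (frakK κ hκ).PointedExt (sub hκ e θ.ord ∅)) (hx : PointedExt.IsFullTheory x) :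
    ∃ D : Ultrafilter θ.ord.ToType,
      D.IsUniform ∧ CardinalInterFilter (D : Filter θ.ord.ToType) (Order.succ κ) := by
  obtain ⟨t, -, hI, hR⟩ := hx
  have hN : IsModel κ hκ x.carrier := x.strong.2
  -- Every theory has an assignment `s` satisfying it; the ultrafilter consists of the sets that are
  -- true at `s`.
  obtain ⟨s, hJ, rfl⟩ := hN.onto t hI
  let v : Set θ.ord.ToType → sub hκ e θ.ord ∅ := fun A => ⟨var A, trivial⟩
  have key : ∀ f (hf : IsSentence hκ e f) (k : θ.ord.ToType),
      (∀ j, k ≤ j → Sat hκ e f j) → ∃ φ : sub hκ e θ.ord ∅,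
        Is κ .Γ (x.emb φ) ∧ R₂ κ (x.emb φ) s ∧ (∀ i, F i φ = v (f i)) := by
    intro f hf k hk
    let φ : sub hκ e θ.ord ∅ := ⟨sent ⟨f, hf⟩, k, (Ordinal.ToType.toOrd k).2, hk⟩
    have hφ : Is κ .Γ φ := (is_map (sub hκ e θ.ord ∅).subtype .Γ φ).1 rfl
    refine ⟨φ, (is_map _ _ _).2 hφ, hN.models _ _ hJ (hR φ hφ), fun i => ?_⟩
    apply (sub hκ e θ.ord ∅).subtype.injective
    rw [← F_map]
    rfl
  have hcv : ∀ i, c (sub hκ e θ.ord ∅) i = v {e i} := fun i => by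
    apply (sub hκ e θ.ord ∅).subtype.injective
    rw [← c_map]
    rfl
  -- The negation and conjunction sentences hold at every `j`, so any threshold serves for them.
  obtain ⟨k₀⟩ : Nonempty θ.ord.ToType := ⟨e (idx hκ 0)⟩
  obtain ⟨U, hU, hUκ⟩ := exists_ultrafilter hκ {A | R₂ κ (x.emb (v A)) s} (fun A => by
      obtain ⟨φ, hΓ, hT, hφ⟩ := key _ (isSentence_notSentence Aᶜ A) k₀
        fun j _ => sat_notSentence A j
      refine (hN.true_not _ _ (x.emb (v Aᶜ)) (x.emb (v A)) hΓ hJ ((codesNot_map _ _ _ _).2 ?_)).1 hT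
      refine ⟨?_, ?_, fun i hi => ?_⟩
      · rw [hφ, hcv]; simp [notSentence]
      · rw [hφ]; simp [notSentence, (idx_injective hκ).eq_iff]
      · have h0 : i ≠ idx hκ 0 := ((idx_strictMono hκ two_pos).trans_le hi).ne'
        have h1 : i ≠ idx hκ 1 := ((idx_strictMono hκ one_lt_two).trans_le hi).ne'
        rw [hφ]; simp [notSentence, h0, h1])
    (fun S hS hSκ => by
      obtain ⟨g, hg⟩ := exists_surjective_subtype_le_idx hκ 2 S hS hSκ
      obtain ⟨φ, hΓ, hT, hφ⟩ := key _ (isSentence_conjSentence (⋂ i, (g i : Set θ.ord.ToType))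
        fun i => g i) k₀ fun j _ => sat_conjSentence _ j
      have := (hN.true_conj _ _ (x.emb (v (⋂ i, (g i : Set θ.ord.ToType))))
        (fun i => x.emb (v (g i))) hΓ hJ ((codesConj_map _ _ _ _).2 ⟨?_, ?_, fun i => ?_⟩)).1 hT
      · have hS' : ⋂₀ S = ⋂ i, (g i : Set θ.ord.ToType) := by
          rw [sInter_eq_iInter]
          exact (hg.iInter_comp _).symm
        rw [hS']
        refine this.trans ((hg.forall (p := fun A => R₂ κ (x.emb (v A)) s)).symm.trans ?_)
        exact Subtype.forall
      · rw [hφ, hcv, conjSentence_zero]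
      · rw [hφ, conjSentence_one]
      · rw [hφ]; simp [conjSentence, i.2])
  refine ⟨U, isUniform_of_Ici_mem hθ U fun k => (hU _).2 ?_, hUκ⟩
  -- Here the threshold matters: the sentence `(Ici k)` is true exactly from `k` on.
  obtain ⟨φ, hΓ, hT, hφ⟩ := key _ (isSentence_varSentence (Ici k)) k
    fun j hj => (sat_varSentence _ j).2 hj
  refine (hN.true_var _ _ (x.emb (v (Ici k))) hΓ hJ
    ((codesVar_map _ _ _).2 ⟨?_, fun i hi => ?_⟩)).1 hT
  · rw [hφ, hcv]; simp [varSentence]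
  · have h0 : i ≠ idx hκ 0 := ((idx_strictMono hκ one_pos).trans_le hi).ne'
    rw [hφ]; simp [varSentence, h0]

end Ambient

end PropAEC

/-! ### Failure of compactness -/

theorem mainTheorem6 (κ θ lam : Cardinal.{u}) (hκ : ℵ₀ ≤ κ) (hθ : θ.IsRegular) (hκθ : κ < θ)
    (hD : ¬ ∃ D : Ultrafilter θ.ord.ToType,
      D.IsUniform ∧ CardinalInterFilter (D : Filter θ.ord.ToType) (Order.succ κ))
    (hlam : lam = 2 ^ θ) :
    ¬ (PropAEC.frakK κ hκ).IsCompactForTypes lam θ := by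
  open PropAEC PropAEC.Ambient in
  intro hcomp
  obtain ⟨e⟩ : #κ.ord.ToType ≤ #θ.ord.ToType := by simpa using hκθ.le
  obtain ⟨q, hq⟩ := hcomp (chain hκ e)
    (fun i hi => hlam ▸ (mk_subtype_le _).trans (mk_le hκθ.le))
    (fun i hi => (frakK κ hκ).tp (ext i (tail θ i) (fun _ h => h) (tail_nonempty hi)))
    (fun i j hij hj => tp_ext_restrict hij.le hj)
  obtain ⟨x, rfl⟩ := Quot.exists_rep q
  have hfull : ∀ (i : Ordinal.{u}) (hi : i < θ.ord), PointedExt.IsFullTheory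
      (AEC.PointedExt.restrict _ ((chain hκ e).strong ⟨i, hi.le⟩ ⟨θ.ord, mem_Iic.2 le_rfl⟩ hi.le) x) :=
    fun i hi => (PointedExt.isFullTheory_iff_of_tp_eq (hq i hi)).2
      (isFullTheory_ext _ (tail_nonempty hi))
  refine hD (exists_ultrafilter_of_isFullTheory (hκ := hκ) (e := e) hθ x ?_)
  -- Restriction changes neither the sequence nor its ambient model, so any index yields the same
  -- `t`; index `0` is used only to name it.
  obtain ⟨t, ht, hI, -⟩ := hfull 0 hθ.ord_pos
  refine ⟨t, ht, hI, fun φ hφ => ?_⟩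
  rcases φ with ⟨φ, hφm⟩
  have hφ' : φ.kind = .Γ := (is_map (sub hκ e θ.ord ∅).subtype _ _).2 hφ
  cases φ with
  | sent f =>
    obtain ⟨k, hk, h⟩ := hφm
    have hlim : Order.IsSuccLimit θ.ord := isSuccLimit_ord hθ.aleph0_le
    -- A sentence of the last model with threshold `k` lies in the model with index `k + 1 < θ`,
    -- whose type already puts it into the theory.
    obtain ⟨t', ht', -, hR⟩ := hfull _ (hlim.succ_lt hk)
    obtain rfl : t' = t := (List.cons.inj (ht'.symm.trans ht)).1
    exact hR ⟨sent f, k, Order.lt_succ _, h⟩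
      ((is_map (sub hκ e (Order.succ (k : Ordinal.{u})) ∅).subtype .Γ _).1 rfl)
  | _ => cases hφ'
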